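/- Let $n\ge 1$ and let $\varphi:[0,\infty)\to\mathbb{R}$ be continuous with $\varphi(k)>0$ for almost every $k>0$ and $$\int_0^\infty \frac{k^{n-1}}{(1+\varphi(k))^2}\,dk<\infty .$$ Let $A$ be the operator of multiplication by $\varphi(|\mathbf{k}|)$ in the complex Hilbert space $L^2(\mathbb{R}^n)$ with domain $\mathcal{D}(A)=\{f\in L^2(\mathbb{R}^n): \int_{\mathbb{R}^n}(1+\varphi(|\mathbf{k}|))^2|f(\mathbf{k})|^2\,d\mathbf{k}<\infty\}$; under the condition above $\mathcal{D}(A)\subset L^1(\mathbb{R}^n)$. Let $A_0$ be the restriction of $A$ to $\{f\in\mathcal{D}(A): \int_{\mathbb{R}^n} f(\mathbf{k})\,d\mathbf{k}=0\}$. Then $A$ is the unique non-negative self-adjoint extension of $A_0$ in $L^2(\mathbb{R}^n)$ if and only if $$\int_0^\infty \frac{k^{n-1}}{\varphi(k)(1+\varphi(k))}\,dk=\infty\quad\text{and}\quad \int_0^\infty \frac{k^{n-1}}{1+\varphi(k)}\,dk=\infty .$$ Equivalently, these two conditions hold if and only if $A$ has no non-negative singular perturbation, that is, there is no non-negative self-adjoint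 extension of $A_0$ in $L^2(\mathbb{R}^n)$ other than $A$. -/

import Mathlib

open MeasureTheory Set
open scoped ENNReal

noncomputable section

namespace SingularPerturbation

/-- The Hilbert space `L²(ℝⁿ)` of complex-valued functions. -/
abbrev L2 (n : ℕ) : Type :=
  Lp ℂ 2 (volume : Measure (EuclideanSpace ℝ (Fin n)))

/-- The natural (maximal) domain `{f ∈ L² : φ(|·|) f ∈ L²}` of multiplication by the radial
function `k ↦ φ(|k|)`. -/
def mulDomain (n : ℕ) (φ : ℝ → ℝ) : Submodule ℂ (L2 n) where
  carrier := {f | MemLp (fun k => (φ ‖k‖ : ℂ) * f k) 2 volume}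
  zero_mem' := by
    refine (MemLp.zero (ε := ℂ)).ae_eq ?_
    filter_upwards [Lp.coeFn_zero ℂ 2 (volume : Measure (EuclideanSpace ℝ (Fin n)))] with k hk
    rw [hk, Pi.zero_apply, mul_zero]
  add_mem' := by
    intro f g hf hg
    refine (MemLp.add hf hg).ae_eq ?_
    filter_upwards [Lp.coeFn_add f g] with k hk
    rw [hk, Pi.add_apply]
    exact (mul_add _ _ _).symm
  smul_mem' := by
    intro c f hf
    refine (MemLp.const_smul hf c).ae_eq ?_
    filter_upwards [Lp.coeFn_smul c f] with k hk
    rw [hk, Pi.smul_apply, Pi.smul_apply]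
    exact (mul_smul_comm _ _ _).symm

/-- The product `φ(|·|) f ∈ L²` for `f` in the natural domain. -/
def mulFun {n : ℕ} {φ : ℝ → ℝ} (f : mulDomain n φ) : L2 n :=
  MemLp.toLp (fun k => (φ ‖k‖ : ℂ) * (f : L2 n) k) f.2

theorem coeFn_mulFun {n : ℕ} {φ : ℝ → ℝ} (f : mulDomain n φ) :
    mulFun f =ᵐ[volume] fun k => (φ ‖k‖ : ℂ) * (f : L2 n) k :=
  MemLp.coeFn_toLp _

/-- Multiplication by the radial function `k ↦ φ(|k|)` in `L²(ℝⁿ)`, on its natural domain. -/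
def mulOp (n : ℕ) (φ : ℝ → ℝ) : L2 n →ₗ.[ℂ] L2 n where
  domain := mulDomain n φ
  toFun :=
    { toFun := mulFun
      map_add' := by
        intro f g
        apply Lp.ext
        filter_upwards [coeFn_mulFun (f + g), coeFn_mulFun f, coeFn_mulFun g,
          Lp.coeFn_add (f : L2 n) (g : L2 n), Lp.coeFn_add (mulFun f) (mulFun g)]
          with k h1 h2 h3 h4 h5
        rw [h1, h5, Submodule.coe_add, h4, Pi.add_apply, Pi.add_apply, h2, h3, mul_add]
      map_smul' := by
        intro c f
        apply Lp.ext
        filter_upwards [coeFn_mulFun (c • f), coeFn_mulFun f,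
          Lp.coeFn_smul c (f : L2 n), Lp.coeFn_smul c (mulFun f)] with k h1 h2 h3 h4
        rw [h1, RingHom.id_apply, h4, Submodule.coe_smul, h3, Pi.smul_apply, Pi.smul_apply, h2,
          mul_smul_comm] }

/-- The unbounded linear functional `f ↦ ∫ f(k) dk` in `L²(ℝⁿ)`, with domain
`L²(ℝⁿ) ∩ L¹(ℝⁿ)`. -/
def deltaHat (n : ℕ) : L2 n →ₗ.[ℂ] ℂ where
  domain :=
    { carrier := {f | Integrable (fun k => f k) volume}
      zero_mem' := (integrable_zero _ ℂ _).congr (Lp.coeFn_zero ℂ 2 _).symm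
      add_mem' := fun {f g} hf hg => (Integrable.add hf hg).congr (Lp.coeFn_add f g).symm
      smul_mem' := fun c f hf => (Integrable.smul c hf).congr (Lp.coeFn_smul c f).symm }
  toFun :=
    { toFun := fun f => ∫ k, (f : L2 n) k
      map_add' := fun f g =>
        (integral_congr_ae (Lp.coeFn_add (f : L2 n) (g : L2 n))).trans (integral_add f.2 g.2)
      map_smul' := fun c f =>
        (integral_congr_ae (Lp.coeFn_smul c (f : L2 n))).trans (integral_smul c _) }

/-- The linear set `{f ∈ L² ∩ L¹ : ∫ f = 0}`, the kernel of `deltaHat`. -/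
def kerDeltaHat (n : ℕ) : Submodule ℂ (L2 n) :=
  (LinearMap.ker (deltaHat n).toFun).map (deltaHat n).domain.subtype

/-- The restriction `A₀` of the multiplication operator `A = mulOp n φ` to
`{f ∈ D(A) : ∫ f = 0}`. -/
def mulOp₀ (n : ℕ) (φ : ℝ → ℝ) : L2 n →ₗ.[ℂ] L2 n :=
  (mulOp n φ).domRestrict (kerDeltaHat n)

section Extensions

variable {H : Type*} [NormedAddCommGroup H] [InnerProductSpace ℂ H] [CompleteSpace H]

/-- `B` is a non-negative self-adjoint operator (Mathlib's self-adjointness of a partially defined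
operator, `B† = B`, forces the domain to be dense). -/
def IsNonnegSelfAdjoint (B : H →ₗ.[ℂ] H) : Prop :=
  IsSelfAdjoint B ∧ ∀ x : B.domain, 0 ≤ (inner ℂ (B x) (x : H)).re

/-- `A` is the unique non-negative self-adjoint extension of `A₀` in `H`. -/
def IsUniqueNonnegExtension (A₀ A : H →ₗ.[ℂ] H) : Prop :=
  (IsNonnegSelfAdjoint A ∧ A₀ ≤ A) ∧
    ∀ B : H →ₗ.[ℂ] H, IsNonnegSelfAdjoint B → A₀ ≤ B → B = A

/-- A singular perturbation of `A` (relative to the restriction `A₀` of `A`): a self-adjoint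
extension of `A₀` in `H` other than `A`. -/
def IsSingularPerturbation (A₀ A B : H →ₗ.[ℂ] H) : Prop :=
  IsSelfAdjoint B ∧ A₀ ≤ B ∧ B ≠ A

end Extensions

end SingularPerturbation

end

/-! Everything is read off from `R = (A + 1)⁻¹`, which is multiplication by `w = (1 + φ)⁻¹`, so `0 ≤
R ≤ 1`. For `f ∈ D(A)` one has `∫ f = ⟪w, (A + 1) f⟫`, hence `A₀` is `A` restricted to `R (w^⊥)`.
Krein's resolvent argument then shows that the non-negative self-adjoint extensions `B ≠ A`
correspond to the operators `(B + 1)⁻¹ = R + c ⟪w, ·⟫ w` with `c ≠ 0` real and values between `0`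
and `1`. For `c < 0` only the lower bound matters, for `c > 0` only the upper one, so such a `B`
exists iff `R` or `1 - R` dominates a positive multiple of the rank one form of `w`
(`exists_nonneg_extension_ne_iff`).

By Cauchy–Schwarz, multiplication by `m` dominates such a multiple iff `∫ w² / m < ∞`
(`exists_rankOne_le_iff_integrable`). The choices `m = w` and `m = 1 - w = φ w` give `∫ 1 / (1 + φ)`
and `∫ 1 / (φ (1 + φ))`, and polar coordinates turn these into the stated integrals. -/

namespace SingularPerturbation

/-! ### Rank one perturbations of the resolvent in a Hilbert space -/

section Abstract

variable {H : Type*} [NormedAddCommGroup H] [InnerProductSpace ℂ H]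

local notation "⟪" x ", " y "⟫" => inner ℂ x y

/-- `R` is the everywhere defined inverse of `A + 1`. -/
structure IsShiftedInverse (A : H →ₗ.[ℂ] H) (R : H →ₗ[ℂ] H) : Prop where
  mem_domain : ∀ g, R g ∈ A.domain
  apply_add : ∀ g, A ⟨R g, mem_domain g⟩ + R g = g
  map_apply_add : ∀ f : A.domain, R (A f + f) = f

theorem IsShiftedInverse.apply_eq_sub {A : H →ₗ.[ℂ] H} {R : H →ₗ[ℂ] H}
    (hR : IsShiftedInverse A R) {g x : H} (hx : x = R g) (h : x ∈ A.domain) :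
    A ⟨x, h⟩ = g - x := by
  subst hx
  exact eq_sub_of_add_eq (hR.apply_add g)

theorem exists_isShiftedInverse {S : H →ₗ[ℂ] H} (hS : Function.Injective S) :
    ∃ B : H →ₗ.[ℂ] H, B.domain = LinearMap.range S ∧ IsShiftedInverse B S := by
  let e := LinearEquiv.ofInjective S hS
  refine ⟨⟨LinearMap.range S, e.symm.toLinearMap - (LinearMap.range S).subtype⟩, rfl,
    fun g => ⟨g, rfl⟩, fun g => ?_, fun f => ?_⟩
  · change e.symm (e g) - S g + S g = g
    simp
  · change S (e.symm f - f + f) = f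
    rw [sub_add_cancel]
    exact congrArg Subtype.val (e.apply_symm_apply f)

/-- A symmetric operator `0 ≤ S ≤ 1` satisfies `S ^ 2 ≤ S`. -/
theorem norm_sq_map_le_re_inner {S : H →ₗ[ℂ] H} (hsym : S.IsSymmetric)
    (h0 : ∀ g, 0 ≤ (⟪S g, g⟫).re) (h1 : ∀ g, (⟪S g, g⟫).re ≤ ‖g‖ ^ 2) (g : H) :
    ‖S g‖ ^ 2 ≤ (⟪S g, g⟫).re := by
  -- The two bounds are added through `S - S² = S (1 - S) S + (1 - S) S (1 - S)`.
  have ha := h1 (S g)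
  have hb := h0 (g - S g)
  have h2 : (⟪S (S g), g⟫).re = ‖S g‖ ^ 2 := by
    rw [hsym, inner_self_eq_norm_sq_to_K]; norm_cast
  have h3 : (⟪S g, S g⟫).re = ‖S g‖ ^ 2 := by
    rw [inner_self_eq_norm_sq_to_K]; norm_cast
  rw [map_sub, inner_sub_left, inner_sub_right, inner_sub_right, Complex.sub_re,
    Complex.sub_re, Complex.sub_re, h2, h3] at hb
  linarith

theorem re_inner_add_rankOne (R : H →ₗ[ℂ] H) (h g : H) (c : ℝ) :
    (⟪R g + ((c : ℂ) * ⟪h, g⟫) • h, g⟫).re = (⟪R g, g⟫).re + c * ‖⟪h, g⟫‖ ^ 2 := by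
  rw [inner_add_left, inner_smul_left, map_mul, Complex.conj_ofReal, mul_assoc,
    mul_comm (starRingEnd ℂ _), Complex.mul_conj, Complex.normSq_eq_norm_sq, Complex.add_re]
  norm_cast

variable [CompleteSpace H]

/-- Since `B + 1` is onto, only `0` is orthogonal to its range. This gives density: if `z = (B + 1)
x` is orthogonal to the domain, symmetry makes `x` orthogonal to that range. It also gives `D(B†) ⊆
D(B)`: if `(B + 1) x = (B† + 1) y`, then `y - x` is orthogonal to it. -/
theorem isSelfAdjoint_of_isFormalAdjoint_of_surjective {B : H →ₗ.[ℂ] H}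
    (hB : B.IsFormalAdjoint B) (hsurj : ∀ z : H, ∃ x : B.domain, B x + x = z) :
    IsSelfAdjoint B := by
  have hker : ∀ z : H, (∀ y : B.domain, ⟪z, B y + y⟫ = 0) → z = 0 := by
    intro z hz
    obtain ⟨y, hy⟩ := hsurj z
    have := hz y
    rwa [hy, inner_self_eq_zero] at this
  have hd : Dense (B.domain : Set H) := by
    rw [Submodule.dense_iff_topologicalClosure_eq_top,
      Submodule.topologicalClosure_eq_top_iff, Submodule.eq_bot_iff]
    intro z hz
    obtain ⟨x, rfl⟩ := hsurj z
    have hx : (x : H) = 0 := by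
      refine hker _ fun y => ?_
      rw [inner_add_right, ← hB x y, ← inner_add_left]
      exact Submodule.inner_left_of_mem_orthogonal y.2 hz
    have hx' : x = 0 := Subtype.ext hx
    simp [hx']
  have hle : B ≤ B.adjoint := LinearPMap.IsFormalAdjoint.le_adjoint hd hB
  rw [LinearPMap.isSelfAdjoint_def]
  refine (LinearPMap.eq_of_le_of_domain_eq hle (le_antisymm hle.1 fun y hy => ?_)).symm
  obtain ⟨x, hx⟩ := hsurj (B.adjoint ⟨y, hy⟩ + y)
  have : y - x = 0 := by
    refine hker _ fun u => ?_
    have h1 := LinearPMap.adjoint_isFormalAdjoint hd ⟨y, hy⟩ u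
    have h2 := hB x u
    have h3 : ⟪B.adjoint ⟨y, hy⟩ + y, (u : H)⟫ = ⟪B x + x, (u : H)⟫ := by rw [hx]
    rw [inner_add_left, inner_add_left, h1, h2] at h3
    rw [inner_sub_left, inner_add_right, inner_add_right]
    exact sub_eq_zero.2 h3
  rw [sub_eq_zero.1 this]
  exact x.2

theorem isFormalAdjoint_self_of_isSelfAdjoint {B : H →ₗ.[ℂ] H} (hB : IsSelfAdjoint B) :
    B.IsFormalAdjoint B := by
  have h := LinearPMap.adjoint_isFormalAdjoint hB.dense_domain
  rwa [LinearPMap.isSelfAdjoint_def.1 hB] at h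

theorem eq_of_le_of_isSelfAdjoint {A B : H →ₗ.[ℂ] H} (hA : IsSelfAdjoint A)
    (hB : IsSelfAdjoint B) (h : B ≤ A) : B = A := by
  refine le_antisymm h ?_
  have hf : B.IsFormalAdjoint A := by
    intro x y
    rw [h.2 (x := x) (y := ⟨x, h.1 x.2⟩) rfl]
    exact isFormalAdjoint_self_of_isSelfAdjoint hA ⟨x, h.1 x.2⟩ y
  have := LinearPMap.IsFormalAdjoint.le_adjoint hB.dense_domain hf
  rwa [LinearPMap.isSelfAdjoint_def.1 hB] at this

theorem IsShiftedInverse.isSelfAdjoint {A : H →ₗ.[ℂ] H} {R : H →ₗ[ℂ] H}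
    (hR : IsShiftedInverse A R) (hsym : R.IsSymmetric) : IsSelfAdjoint A := by
  refine isSelfAdjoint_of_isFormalAdjoint_of_surjective ?_
    fun z => ⟨⟨R z, hR.mem_domain z⟩, hR.apply_add z⟩
  intro x y
  have h := hsym (A x + x) (A y + y)
  rw [hR.map_apply_add, hR.map_apply_add, inner_add_left, inner_add_right] at h
  exact (add_right_cancel h).symm

/-- At `g = (A + 1) x` the bound reads `‖x‖² ≤ Re ⟪x, A x⟫ + ‖x‖²`. -/
theorem IsShiftedInverse.isNonnegSelfAdjoint {A : H →ₗ.[ℂ] H} {R : H →ₗ[ℂ] H}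
    (hR : IsShiftedInverse A R) (hsym : R.IsSymmetric)
    (hle : ∀ g, ‖R g‖ ^ 2 ≤ (⟪R g, g⟫).re) : IsNonnegSelfAdjoint A := by
  refine ⟨hR.isSelfAdjoint hsym, fun x => ?_⟩
  have h := hle (A x + x)
  have h2 : (⟪(x : H), (x : H)⟫).re = ‖(x : H)‖ ^ 2 := by
    rw [inner_self_eq_norm_sq_to_K]; norm_cast
  rw [hR.map_apply_add, inner_add_right, Complex.add_re, h2] at h
  rw [← inner_conj_symm, Complex.conj_re]
  linarith

/-- Necessity half of Krein's formula: `B + 1` inverts `R` on `h^⊥`, and one further vector `y ∈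
D(B) \ D(A)` fixes `(B + 1)⁻¹` on the remaining dimension. -/
theorem exists_isShiftedInverse_add_rankOne {A₀ A B : H →ₗ.[ℂ] H} {R : H →ₗ[ℂ] H} {h : H}
    (hR : IsShiftedInverse A R) (hsym : R.IsSymmetric)
    (hle : A₀ ≤ A) (hdom : ∀ f : A.domain, (f : H) ∈ A₀.domain ↔ ⟪h, A f + f⟫ = 0)
    (hh : h ≠ 0) (hA : IsSelfAdjoint A) (hB : IsNonnegSelfAdjoint B) (hle' : A₀ ≤ B) (hne : B ≠ A) :
    ∃ γ : ℂ, γ ≠ 0 ∧ ∀ v : H, ∃ hv : R v + (γ * ⟪h, v⟫) • h ∈ B.domain,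
      B ⟨_, hv⟩ + (R v + (γ * ⟪h, v⟫) • h) = v := by
  have hker : ∀ v : H, ⟪h, v⟫ = 0 → ∃ hv : R v ∈ B.domain, B ⟨R v, hv⟩ = v - R v := by
    intro v hv
    have h0 : R v ∈ A₀.domain :=
      (hdom ⟨R v, hR.mem_domain v⟩).2 (by rw [hR.apply_add]; exact hv)
    refine ⟨hle'.1 h0, ?_⟩
    rw [← hle'.2 (x := ⟨R v, h0⟩) rfl, hle.2 (x := ⟨R v, h0⟩) (y := ⟨R v, hR.mem_domain v⟩) rfl]
    exact hR.apply_eq_sub rfl _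
  have hBs := isFormalAdjoint_self_of_isSelfAdjoint hB.1
  have hdec : ∀ y : B.domain, ∃ α : ℂ, R (B y + y) + α • h = y := by
    intro y
    -- Symmetry of `B` and `R`, tested against `R v` with `v ⊥ h`, puts this difference in `h^⊥⊥`.
    have hz : (y : H) - R (B y + y) ∈ (ℂ ∙ h) := by
      rw [← Submodule.orthogonal_orthogonal (ℂ ∙ h), Submodule.mem_orthogonal']
      intro v hv
      have hv0 := Submodule.mem_orthogonal_singleton_iff_inner_right.1 hv
      obtain ⟨hv1, hv2⟩ := hker v hv0
      have h1 := hBs y ⟨R v, hv1⟩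
      rw [hv2, inner_sub_right] at h1
      rw [inner_sub_left, hsym, inner_add_left]
      rw [h1]
      ring
    obtain ⟨α, hα⟩ := Submodule.mem_span_singleton.1 hz
    exact ⟨α, by rw [hα]; abel⟩
  -- If every `α` vanished, then `B ≤ A`, and self-adjoint operators have no proper self-adjoint
  -- extension.
  obtain ⟨y, α, hα, hy⟩ : ∃ (y : B.domain) (α : ℂ), α ≠ 0 ∧ R (B y + y) + α • h = y := by
    by_contra! hcon
    refine hne (eq_of_le_of_isSelfAdjoint hA hB.1 ?_)
    have hall : ∀ y : B.domain, R (B y + y) = y := by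
      intro y
      obtain ⟨α, hα⟩ := hdec y
      by_cases h0 : α = 0
      · simpa [h0] using hα
      · exact absurd hα (hcon y α h0)
    refine ⟨fun y hy => ?_, fun x y hxy => ?_⟩
    · have h2 := hR.mem_domain (B ⟨y, hy⟩ + y)
      rwa [hall ⟨y, hy⟩] at h2
    · obtain ⟨y, hy⟩ := y
      have hyx : y = x := hxy.symm
      subst hyx
      rw [hR.apply_eq_sub (g := B x + x) (hall x).symm hy, add_sub_cancel_right]
  set g := B y + y with hg
  -- Otherwise `y - R g = α h` would be an eigenvector of `B` with eigenvalue `-1`.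
  have hβ : ⟪h, g⟫ ≠ 0 := by
    intro h0
    obtain ⟨hv1, hv2⟩ := hker g h0
    have hyn : (y : H) - R g ≠ 0 := by
      rw [← hy, add_sub_cancel_left]
      exact smul_ne_zero hα hh
    have := hB.2 (y - ⟨R g, hv1⟩)
    have h2 : B (y - ⟨R g, hv1⟩) = -((y : H) - R g) := by
      rw [LinearPMap.map_sub, hv2, hg]
      abel
    rw [h2, Submodule.coe_sub, inner_neg_left, Complex.neg_re] at this
    have h3 : (⟪(y : H) - R g, (y : H) - R g⟫).re = ‖(y : H) - R g‖ ^ 2 := by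
      rw [inner_self_eq_norm_sq_to_K]; norm_cast
    have := pow_pos (norm_pos_iff.2 hyn) 2
    linarith
  -- Split `v = t g + (v - t g)` with `v - t g ⊥ h`; the preimages under `B + 1` are `t y` and `R (v
  -- - t g)`.
  refine ⟨α / ⟪h, g⟫, div_ne_zero hα hβ, fun v => ?_⟩
  set t := ⟪h, v⟫ / ⟪h, g⟫ with ht
  obtain ⟨hv1, hv2⟩ := hker (v - t • g) (by
    rw [inner_sub_right, inner_smul_right, ht, div_mul_cancel₀ _ hβ, sub_self])
  have hx : R v + (α / ⟪h, g⟫ * ⟪h, v⟫) • h = ((t • y + ⟨_, hv1⟩ : B.domain) : H) := by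
    have : α / ⟪h, g⟫ * ⟪h, v⟫ = t * α := by rw [ht]; ring
    rw [this, Submodule.coe_add, Submodule.coe_smul]
    change _ = t • (y : H) + R (v - t • g)
    rw [← hy, map_sub, map_smul, smul_add, mul_smul]
    abel
  have hx' : (⟨R v + (α / ⟪h, g⟫ * ⟪h, v⟫) • h, hx ▸ Subtype.prop _⟩ : B.domain)
      = t • y + ⟨_, hv1⟩ := Subtype.ext hx
  refine ⟨hx ▸ Subtype.prop _, ?_⟩
  rw [hx', hx, LinearPMap.map_add, LinearPMap.map_smul, hv2, Submodule.coe_add,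
    Submodule.coe_smul]
  change t • B y + (v - t • g - R (v - t • g)) + (t • (y : H) + R (v - t • g)) = v
  have h2 : t • g = t • B y + t • (y : H) := by rw [hg, smul_add]
  rw [h2]
  abel

/-- Sufficiency half: `B = S⁻¹ - 1` with `S = R + c ⟪h, ·⟫ h`. As `h ∉ D(A)`, `S g ∈ D(A)` forces
`⟪h, g⟫ = 0`; this yields both injectivity of `S` and `B ≠ A`. On `h^⊥` the maps `S` and `R` agree,
so `B` extends `A₀`. -/
theorem exists_nonneg_extension_of_rankOne {A₀ A : H →ₗ.[ℂ] H} {R : H →ₗ[ℂ] H} {h : H}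
    (hR : IsShiftedInverse A R) (hsym : R.IsSymmetric)
    (hle : A₀ ≤ A) (hdom : ∀ f : A.domain, (f : H) ∈ A₀.domain ↔ ⟪h, A f + f⟫ = 0)
    (hh : h ∉ A.domain) {c : ℝ} (hc : c ≠ 0)
    (h0 : ∀ g, 0 ≤ (⟪R g, g⟫).re + c * ‖⟪h, g⟫‖ ^ 2)
    (h1 : ∀ g, (⟪R g, g⟫).re + c * ‖⟪h, g⟫‖ ^ 2 ≤ ‖g‖ ^ 2) :
    ∃ B : H →ₗ.[ℂ] H, IsNonnegSelfAdjoint B ∧ A₀ ≤ B ∧ B ≠ A := by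
  let S : H →ₗ[ℂ] H := R + (c : ℂ) • ((innerₛₗ ℂ h).smulRight h)
  have hSapp : ∀ g, S g = R g + ((c : ℂ) * ⟪h, g⟫) • h := fun g => by
    simp [S, mul_smul]
  have hc' : (c : ℂ) ≠ 0 := Complex.ofReal_ne_zero.2 hc
  have hmem : ∀ g, S g ∈ A.domain → ⟪h, g⟫ = 0 := by
    intro g hg
    by_contra h0
    rw [hSapp, A.domain.add_mem_iff_right (hR.mem_domain g),
      A.domain.smul_mem_iff (mul_ne_zero hc' h0)] at hg
    exact hh hg
  have hinj : Function.Injective S := by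
    rw [← LinearMap.ker_eq_bot, LinearMap.ker_eq_bot']
    intro g hg
    have h2 := hmem g (hg ▸ A.domain.zero_mem)
    have h3 : R g = 0 := by simpa [hSapp, h2] using hg
    have h4 := hR.apply_eq_sub h3.symm A.domain.zero_mem
    have h5 : A ⟨0, A.domain.zero_mem⟩ = 0 := A.map_zero
    rw [h5, sub_zero] at h4
    exact h4.symm
  have hSsym : S.IsSymmetric := by
    intro x y
    rw [hSapp, hSapp, inner_add_left, inner_add_right, hsym, inner_smul_left, inner_smul_right,
      map_mul, Complex.conj_ofReal, inner_conj_symm]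
    ring
  obtain ⟨B, hBd, hB⟩ := exists_isShiftedInverse hinj
  refine ⟨B, hB.isNonnegSelfAdjoint hSsym (norm_sq_map_le_re_inner hSsym (fun g => ?_)
    fun g => ?_), ⟨fun f hf => ?_, fun x y hxy => ?_⟩, ?_⟩
  · rw [hSapp, re_inner_add_rankOne]; exact h0 g
  · rw [hSapp, re_inner_add_rankOne]; exact h1 g
  · have h2 := (hdom ⟨f, hle.1 hf⟩).1 hf
    have h3 := hR.map_apply_add ⟨f, hle.1 hf⟩
    rw [hBd]
    exact ⟨A ⟨f, hle.1 hf⟩ + f, by rw [hSapp, h2, mul_zero, zero_smul, add_zero]; exact h3⟩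
  · have h2 := (hdom ⟨x, hle.1 x.2⟩).1 x.2
    have h3 := hR.map_apply_add ⟨x, hle.1 x.2⟩
    obtain ⟨y, hy⟩ := y
    have hyx : y = x := hxy.symm
    subst hyx
    rw [hle.2 (y := ⟨x, hle.1 x.2⟩) rfl, hB.apply_eq_sub (g := A ⟨x, hle.1 x.2⟩ + x) (by
      rw [hSapp, h2, mul_zero, zero_smul, add_zero]; exact h3.symm)]
    exact (add_sub_cancel_right _ _).symm
  · rintro rfl
    have h2 := hmem h (hB.mem_domain h)
    rw [inner_self_eq_zero] at h2
    exact hh (h2 ▸ B.domain.zero_mem)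

/-- Let `A` be self-adjoint with `R = (A + 1)⁻¹` and `0 ≤ R ≤ 1`, and let `A₀` be its restriction
to `{f : ⟪h, (A + 1) f⟫ = 0}`. Then `A₀` has a non-negative self-adjoint extension other than `A`
if and only if one of the forms `R` and `1 - R` dominates a multiple of the rank one form
of `h`. -/
theorem exists_nonneg_extension_ne_iff {A₀ A : H →ₗ.[ℂ] H} {R : H →ₗ[ℂ] H} {h : H}
    (hR : IsShiftedInverse A R) (hsym : R.IsSymmetric)
    (h0 : ∀ g, 0 ≤ (⟪R g, g⟫).re) (h1 : ∀ g, (⟪R g, g⟫).re ≤ ‖g‖ ^ 2)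
    (hle : A₀ ≤ A) (hdom : ∀ f : A.domain, (f : H) ∈ A₀.domain ↔ ⟪h, A f + f⟫ = 0)
    (hh : h ∉ A.domain) :
    (∃ B : H →ₗ.[ℂ] H, IsNonnegSelfAdjoint B ∧ A₀ ≤ B ∧ B ≠ A) ↔
      (∃ c : ℝ, 0 < c ∧ ∀ g, c * ‖⟪h, g⟫‖ ^ 2 ≤ (⟪R g, g⟫).re) ∨
      (∃ c : ℝ, 0 < c ∧ ∀ g, c * ‖⟪h, g⟫‖ ^ 2 ≤ ‖g‖ ^ 2 - (⟪R g, g⟫).re) := by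
  have hh0 : h ≠ 0 := fun h2 => hh (h2 ▸ A.domain.zero_mem)
  constructor
  · rintro ⟨B, hB, hle', hne⟩
    obtain ⟨γ, hγ, hS⟩ := exists_isShiftedInverse_add_rankOne hR hsym hle hdom hh0
      (hR.isSelfAdjoint hsym) hB hle' hne
    have hBs := isFormalAdjoint_self_of_isSelfAdjoint hB.1
    -- For `x = (B + 1)⁻¹ v`, non-negativity of `B` says that `(B + 1)⁻¹` is symmetric with form
    -- between `0` and `1`.
    have key : ∀ v x : H, (∃ hx : x ∈ B.domain, B ⟨x, hx⟩ + x = v) →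
        ⟪x, v⟫ = ⟪v, x⟫ ∧ ‖x‖ ^ 2 ≤ (⟪x, v⟫).re ∧ (⟪x, v⟫).re ≤ ‖v‖ ^ 2 := by
      rintro v x ⟨hx, rfl⟩
      have hs := hBs ⟨x, hx⟩ ⟨x, hx⟩
      have hn := hB.2 ⟨x, hx⟩
      have h2 : (⟪x, x⟫).re = ‖x‖ ^ 2 := by
        rw [inner_self_eq_norm_sq_to_K]; norm_cast
      have h3 := norm_add_sq (𝕜 := ℂ) (B ⟨x, hx⟩) x
      change 0 ≤ (⟪B ⟨x, hx⟩, x⟫).re at hn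
      change ⟪B ⟨x, hx⟩, x⟫ = ⟪x, B ⟨x, hx⟩⟫ at hs
      change _ = _ + 2 * (⟪B ⟨x, hx⟩, x⟫).re + _ at h3
      rw [inner_add_left, inner_add_right, hs, Complex.add_re, h2, ← hs]
      refine ⟨rfl, by linarith, ?_⟩
      rw [h3]
      nlinarith [sq_nonneg ‖B ⟨x, hx⟩‖]
    -- The form at `v = h` is real, and so is its part `⟪R h, h⟫`; what remains is `γ` times `⟪h,
    -- h⟫²`, up to conjugation.
    have hγim : γ.im = 0 := by
      have h2 := (key h _ (hS h)).1
      rw [inner_add_left, inner_add_right, hsym, inner_smul_left, inner_smul_right, map_mul,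
        inner_conj_symm, add_right_inj, mul_assoc, mul_assoc] at h2
      have h3 : ⟪h, h⟫ ≠ 0 := inner_self_ne_zero.2 hh0
      exact Complex.conj_eq_iff_im.1 (mul_right_cancel₀ (mul_ne_zero h3 h3) h2)
    obtain ⟨c, rfl⟩ : ∃ c : ℝ, γ = c := ⟨γ.re, Complex.ext rfl hγim⟩
    have hc : c ≠ 0 := Complex.ofReal_ne_zero.1 hγ
    rcases hc.lt_or_gt with hneg | hpos
    · refine Or.inl ⟨-c, neg_pos.2 hneg, fun g => ?_⟩
      have h2 := (sq_nonneg _).trans (key g _ (hS g)).2.1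
      rw [re_inner_add_rankOne] at h2
      linarith
    · refine Or.inr ⟨c, hpos, fun g => ?_⟩
      have h2 := (key g _ (hS g)).2.2
      rw [re_inner_add_rankOne] at h2
      linarith
  · rintro (⟨c, hc, hcg⟩ | ⟨c, hc, hcg⟩)
    · refine exists_nonneg_extension_of_rankOne hR hsym hle hdom hh (neg_ne_zero.2 hc.ne')
        (fun g => ?_) fun g => ?_
      · linarith [hcg g]
      · have := mul_nonneg hc.le (sq_nonneg ‖⟪h, g⟫‖)
        linarith [h1 g]
    · refine exists_nonneg_extension_of_rankOne hR hsym hle hdom hh hc.ne'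
        (fun g => ?_) fun g => ?_
      · have := mul_nonneg hc.le (sq_nonneg ‖⟪h, g⟫‖)
        linarith [h0 g]
      · linarith [hcg g]

end Abstract
end SingularPerturbation

/-! ### Quadratic forms of bounded multiplication operators in `L²` -/

namespace SingularPerturbation

section Forms

variable {α : Type*} [MeasurableSpace α] {μ : Measure α}

theorem memLp_bounded_mul {m : α → ℝ} {f : α → ℂ} (hm : Measurable m) {C : ℝ}
    (hC : ∀ x, |m x| ≤ C) (hf : MemLp f 2 μ) : MemLp (fun x => (m x : ℂ) * f x) 2 μ := by
  refine hf.of_le_mul (c := C)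
    ((Complex.measurable_ofReal.comp hm).aestronglyMeasurable.mul hf.1) (ae_of_all _ fun x => ?_)
  rw [norm_mul, Complex.norm_real]
  exact mul_le_mul_of_nonneg_right (hC x) (norm_nonneg _)

/-- Multiplication by a bounded measurable real function in `L²`. -/
noncomputable def boundedMul (m : α → ℝ) (hm : Measurable m) (C : ℝ) (hC : ∀ x, |m x| ≤ C) :
    Lp ℂ 2 μ →ₗ[ℂ] Lp ℂ 2 μ where
  toFun f := (memLp_bounded_mul hm hC (Lp.memLp f)).toLp fun x => (m x : ℂ) * f x
  map_add' f g := by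
    rw [← MemLp.toLp_add]
    refine MemLp.toLp_congr _ _ ?_
    filter_upwards [Lp.coeFn_add f g] with x hx
    simp only [hx, Pi.add_apply, mul_add]
  map_smul' c f := by
    refine Lp.ext ?_
    filter_upwards [Lp.coeFn_smul c f, (memLp_bounded_mul hm hC (Lp.memLp (c • f))).coeFn_toLp,
      (memLp_bounded_mul hm hC (Lp.memLp f)).coeFn_toLp,
      Lp.coeFn_smul c ((memLp_bounded_mul hm hC (Lp.memLp f)).toLp _)] with x h1 h2 h3 h4
    rw [RingHom.id_apply, h4, Pi.smul_apply, h3, h2, h1, Pi.smul_apply, smul_eq_mul, smul_eq_mul,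
      mul_left_comm]

variable {m : α → ℝ} {hm : Measurable m} {C : ℝ} {hC : ∀ x, |m x| ≤ C}

theorem coeFn_boundedMul (f : Lp ℂ 2 μ) :
    boundedMul m hm C hC f =ᵐ[μ] fun x => (m x : ℂ) * f x :=
  (memLp_bounded_mul hm hC (Lp.memLp f)).coeFn_toLp

theorem boundedMul_isSymmetric : (boundedMul (μ := μ) m hm C hC).IsSymmetric := by
  intro f g
  rw [L2.inner_def, L2.inner_def]
  refine integral_congr_ae ?_
  filter_upwards [coeFn_boundedMul (hm := hm) (hC := hC) f,
    coeFn_boundedMul (hm := hm) (hC := hC) g] with x hf hg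
  rw [hf, hg, RCLike.inner_apply, RCLike.inner_apply, map_mul, Complex.conj_ofReal]
  ring

theorem integrable_mul_norm_sq (hm : Measurable m) (hC : ∀ x, |m x| ≤ C) (f : Lp ℂ 2 μ) :
    Integrable (fun x => m x * ‖f x‖ ^ 2) μ :=
  ((memLp_two_iff_integrable_sq_norm (Lp.memLp f).1).1 (Lp.memLp f)).bdd_mul
    hm.aestronglyMeasurable (ae_of_all _ hC)

theorem re_inner_boundedMul (f : Lp ℂ 2 μ) :
    (inner ℂ (boundedMul m hm C hC f) f).re = ∫ x, m x * ‖f x‖ ^ 2 ∂μ := by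
  rw [L2.inner_def, ← Complex.ofReal_re (∫ x, m x * ‖f x‖ ^ 2 ∂μ), ← integral_complex_ofReal]
  congr 1
  refine integral_congr_ae ?_
  filter_upwards [coeFn_boundedMul (hm := hm) (hC := hC) f] with x hf
  rw [hf, RCLike.inner_apply, map_mul, Complex.conj_ofReal, mul_left_comm, Complex.mul_conj,
    Complex.normSq_eq_norm_sq]
  push_cast
  rfl

theorem norm_sq_eq_integral (f : Lp ℂ 2 μ) : ‖f‖ ^ 2 = ∫ x, ‖f x‖ ^ 2 ∂μ := by
  have h : (inner ℂ f f).re = ‖f‖ ^ 2 := by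
    rw [inner_self_eq_norm_sq_to_K]; norm_cast
  rw [← h, L2.inner_def, ← Complex.ofReal_re (∫ x, ‖f x‖ ^ 2 ∂μ), ← integral_complex_ofReal]
  congr 2
  funext x
  rw [RCLike.inner_apply, Complex.mul_conj, Complex.normSq_eq_norm_sq]

theorem inner_toLp_ofReal {w : α → ℝ} (hw : MemLp (fun x => (w x : ℂ)) 2 μ) (g : Lp ℂ 2 μ) :
    inner ℂ (hw.toLp _) g = ∫ x, (w x : ℂ) * g x ∂μ := by
  rw [L2.inner_def]
  refine integral_congr_ae ?_
  filter_upwards [hw.coeFn_toLp] with x hx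
  rw [hx, RCLike.inner_apply, Complex.conj_ofReal, mul_comm]

/-- The form of multiplication by `m` dominates a multiple of the rank one form of `w` if and only
if `w ^ 2 / m` is integrable. -/
theorem exists_rankOne_le_iff_integrable {m w : α → ℝ} (hm : Measurable m)
    (hC : ∀ x, |m x| ≤ C) (hpos : ∀ᵐ x ∂μ, 0 < m x) (hwm : Measurable w)
    (hw : MemLp (fun x => (w x : ℂ)) 2 μ) :
    (∃ c : ℝ, 0 < c ∧ ∀ g : Lp ℂ 2 μ,
      c * ‖inner ℂ (hw.toLp _) g‖ ^ 2 ≤ ∫ x, m x * ‖g x‖ ^ 2 ∂μ) ↔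
    Integrable (fun x => w x ^ 2 / m x) μ := by
  have hw2 : Integrable (fun x => w x ^ 2) μ := by
    simpa using (memLp_two_iff_integrable_sq_norm hw.1).1 hw
  constructor
  · rintro ⟨c, hc, hcg⟩
    -- Truncation to sets where `1 / m` is bounded; they exhaust the space because `m > 0` almost
    -- everywhere.
    let K : ℕ → Set α := fun N => {x | 1 / ((N : ℝ) + 1) ≤ m x}
    have hK : ∀ N, MeasurableSet (K N) := fun N => measurableSet_le measurable_const hm
    have hcover : AECover μ Filter.atTop K := by
      refine ⟨?_, hK⟩
      filter_upwards [hpos] with x hx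
      obtain ⟨N, hN⟩ := exists_nat_one_div_lt hx
      filter_upwards [Filter.eventually_ge_atTop N] with M hM
      exact (one_div_le_one_div_of_le (by positivity) (by gcongr)).trans hN.le
    have hbd : ∀ N x, x ∈ K N → 0 < m x ∧ (m x)⁻¹ ≤ N + 1 := by
      intro N x hx
      have h1 : (0 : ℝ) < 1 / ((N : ℝ) + 1) := by positivity
      refine ⟨h1.trans_le hx, ?_⟩
      have := inv_anti₀ h1 hx
      simpa using this
    have hint : ∀ N, IntegrableOn (fun x => w x ^ 2 / m x) (K N) μ := by
      intro N
      refine (hw2.const_mul ((N : ℝ) + 1)).integrableOn.mono'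
        ((hwm.pow_const 2).div hm).aestronglyMeasurable ?_
      filter_upwards [ae_restrict_mem (hK N)] with x hx
      obtain ⟨h1, h2⟩ := hbd N x hx
      rw [Real.norm_of_nonneg (by positivity), div_eq_inv_mul]
      exact mul_le_mul_of_nonneg_right h2 (sq_nonneg _)
    refine hcover.integrable_of_integral_bounded_of_nonneg_ae (1 / c) hint ?_
      (Filter.Eventually.of_forall fun N => ?_)
    · filter_upwards [hpos] with x hx
      exact div_nonneg (sq_nonneg _) hx.le
    -- For the test function `g = 1_K w / m`, both `⟪w, g⟫` and the form of `m` equal `I`, so `c I²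
    -- ≤ I` and `I ≤ 1 / c` uniformly in `N`.
    · let q : α → ℝ := (K N).indicator fun x => (m x)⁻¹
      have hq : Measurable q := hm.inv.indicator (hK N)
      have hqC : ∀ x, |q x| ≤ (N : ℝ) + 1 := by
        intro x
        by_cases hx : x ∈ K N
        · obtain ⟨h1, h2⟩ := hbd N x hx
          simp only [q, indicator_of_mem hx]
          rwa [abs_of_pos (inv_pos.2 h1)]
        · simp only [q, indicator_of_notMem hx, abs_zero]
          positivity
      have hg := memLp_bounded_mul hq hqC hw
      have h1 := hcg (hg.toLp _)
      set I := ∫ x in K N, w x ^ 2 / m x ∂μ with hI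
      have h2 : inner ℂ (hw.toLp _) (hg.toLp _) = (I : ℂ) := by
        rw [inner_toLp_ofReal, hI, ← integral_complex_ofReal, ← integral_indicator (hK N)]
        refine integral_congr_ae ?_
        filter_upwards [hg.coeFn_toLp] with x hx
        rw [hx]
        by_cases hxK : x ∈ K N
        · simp only [q, indicator_of_mem hxK]
          push_cast
          ring
        · simp [q, indicator_of_notMem hxK]
      have h3 : ∫ x, m x * ‖hg.toLp _ x‖ ^ 2 ∂μ = I := by
        rw [hI, ← integral_indicator (hK N)]
        refine integral_congr_ae ?_
        filter_upwards [hg.coeFn_toLp] with x hx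
        rw [hx]
        by_cases hxK : x ∈ K N
        · have h4 := (hbd N x hxK).1.ne'
          simp only [q, indicator_of_mem hxK]
          rw [norm_mul, Complex.norm_real, Complex.norm_real, mul_pow, Real.norm_eq_abs,
            Real.norm_eq_abs, sq_abs, sq_abs]
          field_simp
        · simp [q, indicator_of_notMem hxK]
      rw [h2, h3, Complex.norm_real, Real.norm_eq_abs, sq_abs] at h1
      rw [le_div_iff₀ hc]
      by_contra! hlt
      have hI0 : 0 < I := by
        by_contra! hI0
        nlinarith
      nlinarith
  · intro hint
    set I := ∫ x, w x ^ 2 / m x ∂μ with hI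
    have hI0 : 0 ≤ I := integral_nonneg_of_ae (by
      filter_upwards [hpos] with x hx
      exact div_nonneg (sq_nonneg _) hx.le)
    -- `I + 1` replaces the Cauchy–Schwarz constant `I`, which may be zero. The factorisation is `w
    -- g = (w / √m) (√m g)`.
    refine ⟨(I + 1)⁻¹, by positivity, fun g => ?_⟩
    have hu : MemLp (fun x => ((w x / √(m x) : ℝ) : ℂ)) 2 μ := by
      refine (memLp_two_iff_integrable_sq_norm
        (Complex.measurable_ofReal.comp (hwm.div hm.sqrt)).aestronglyMeasurable).2
        (hint.congr ?_)
      filter_upwards [hpos] with x hx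
      change _ = ‖((w x / √(m x) : ℝ) : ℂ)‖ ^ 2
      rw [Complex.norm_real, Real.norm_eq_abs, sq_abs, div_pow, Real.sq_sqrt hx.le]
    have hv : MemLp (fun x => ((√(m x) : ℝ) : ℂ) * g x) 2 μ :=
      memLp_bounded_mul (C := √C) hm.sqrt (fun x => by
        rw [abs_of_nonneg (Real.sqrt_nonneg _)]
        exact Real.sqrt_le_sqrt ((le_abs_self _).trans (hC x))) (Lp.memLp g)
    have h1 : inner ℂ (hw.toLp _) g = inner ℂ (hu.toLp _) (hv.toLp _) := by
      rw [inner_toLp_ofReal, inner_toLp_ofReal]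
      refine integral_congr_ae ?_
      filter_upwards [hpos, hv.coeFn_toLp] with x hx hvx
      have h4 : (√(m x) : ℂ) ≠ 0 := Complex.ofReal_ne_zero.2 (Real.sqrt_pos.2 hx).ne'
      rw [hvx]
      push_cast
      field_simp
    have h2 : ‖hu.toLp _‖ ^ 2 = I := by
      rw [norm_sq_eq_integral, hI]
      refine integral_congr_ae ?_
      filter_upwards [hpos, hu.coeFn_toLp] with x hx hux
      rw [hux, Complex.norm_real, Real.norm_eq_abs, sq_abs, div_pow, Real.sq_sqrt hx.le]
    have h3 : ‖hv.toLp _‖ ^ 2 = ∫ x, m x * ‖g x‖ ^ 2 ∂μ := by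
      rw [norm_sq_eq_integral]
      refine integral_congr_ae ?_
      filter_upwards [hpos, hv.coeFn_toLp] with x hx hvx
      rw [hvx, norm_mul, Complex.norm_real, mul_pow, Real.norm_eq_abs, sq_abs,
        Real.sq_sqrt hx.le]
    rw [← h3, h1, inv_mul_le_iff₀ (by positivity)]
    calc ‖inner ℂ (hu.toLp _) (hv.toLp _)‖ ^ 2 ≤ (‖hu.toLp _‖ * ‖hv.toLp _‖) ^ 2 := by
          gcongr
          exact norm_inner_le_norm _ _
      _ = I * ‖hv.toLp _‖ ^ 2 := by rw [mul_pow, h2]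
      _ ≤ (I + 1) * ‖hv.toLp _‖ ^ 2 := by gcongr; linarith

end Forms

/-! ### Radial functions and polar coordinates -/

section Radial

variable {n : ℕ}

theorem integrable_comp_norm_iff (hn : 1 ≤ n) {f : ℝ → ℝ} :
    Integrable (fun x : EuclideanSpace ℝ (Fin n) => f ‖x‖) ↔
      IntegrableOn (fun k => k ^ (n - 1) * f k) (Ioi (0 : ℝ)) := by
  have : Nonempty (Fin n) := ⟨⟨0, hn⟩⟩
  have := integrable_fun_norm_addHaar 
    (volume : Measure (EuclideanSpace ℝ (Fin n))) (f := f)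
  simpa using this

/-- In polar coordinates the indicator of the exceptional set has integral zero over `ℝⁿ`; being
non-negative, it vanishes almost everywhere. -/
theorem ae_comp_norm_of_ae (hn : 1 ≤ n) {p : ℝ → Prop}
    (h : ∀ᵐ k ∂(volume.restrict (Ioi (0 : ℝ))), p k) : ∀ᵐ x : EuclideanSpace ℝ (Fin n), p ‖x‖ := by
  classical
  have : Nonempty (Fin n) := ⟨⟨0, hn⟩⟩
  let f : ℝ → ℝ := fun k => if p k then 0 else 1
  have hf : ∀ᵐ k ∂(volume.restrict (Ioi (0 : ℝ))), k ^ (n - 1) * f k = 0 := by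
    filter_upwards [h] with k hk
    simp [f, hk]
  have hi : Integrable (fun x : EuclideanSpace ℝ (Fin n) => f ‖x‖) :=
    (integrable_comp_norm_iff hn).2 ((integrable_zero _ _ _).congr (by
      filter_upwards [hf] with k hk
      exact hk.symm))
  have h0 : ∫ x : EuclideanSpace ℝ (Fin n), f ‖x‖ = 0 := by
    rw [integral_fun_norm_addHaar]
    simp only [finrank_euclideanSpace, Fintype.card_fin, smul_eq_mul]
    rw [integral_congr_ae hf]
    simp
  rw [integral_eq_zero_iff_of_nonneg (fun x => by simp only [f]; split_ifs <;> simp) hi] at h0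
  filter_upwards [h0] with x hx
  by_contra hpx
  simp [f, hpx] at hx

end Radial

end SingularPerturbation

/-! ### The multiplication operator and its resolvent -/

namespace SingularPerturbation

section Multiplication

variable {n : ℕ} {φ : ℝ → ℝ}

/-- The function `(1 + φ(|k|))⁻¹`. -/
noncomputable def weight (n : ℕ) (φ : ℝ → ℝ) (k : EuclideanSpace ℝ (Fin n)) : ℝ := (1 + φ ‖k‖)⁻¹

theorem weight_pos (h0 : ∀ k : EuclideanSpace ℝ (Fin n), 0 ≤ φ ‖k‖)
    (k : EuclideanSpace ℝ (Fin n)) : 0 < weight n φ k :=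
  inv_pos.2 (by linarith [h0 k])

theorem weight_le_one (h0 : ∀ k : EuclideanSpace ℝ (Fin n), 0 ≤ φ ‖k‖)
    (k : EuclideanSpace ℝ (Fin n)) : weight n φ k ≤ 1 :=
  inv_le_one_of_one_le₀ (by linarith [h0 k])

theorem one_add_mul_weight (h0 : ∀ k : EuclideanSpace ℝ (Fin n), 0 ≤ φ ‖k‖)
    (k : EuclideanSpace ℝ (Fin n)) : φ ‖k‖ * weight n φ k + weight n φ k = 1 := by
  have : 1 + φ ‖k‖ ≠ 0 := by linarith [h0 k]
  rw [weight]
  field_simp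
  ring

theorem abs_weight_le_one (h0 : ∀ k : EuclideanSpace ℝ (Fin n), 0 ≤ φ ‖k‖)
    (k : EuclideanSpace ℝ (Fin n)) : |weight n φ k| ≤ 1 := by
  rw [abs_of_pos (weight_pos h0 k)]
  exact weight_le_one h0 k

theorem abs_one_sub_weight_le_one (h0 : ∀ k : EuclideanSpace ℝ (Fin n), 0 ≤ φ ‖k‖)
    (k : EuclideanSpace ℝ (Fin n)) : |1 - weight n φ k| ≤ 1 := by
  rw [abs_le]
  constructor <;> linarith [weight_pos h0 k, weight_le_one h0 k]

theorem measurable_weight (hφ : Measurable fun k : EuclideanSpace ℝ (Fin n) => φ ‖k‖) :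
    Measurable (weight n φ) :=
  (measurable_const.add hφ).inv

theorem mulOp_apply_ae (f : (mulOp n φ).domain) :
    mulOp n φ f =ᵐ[volume] fun k => (φ ‖k‖ : ℂ) * (f : L2 n) k :=
  coeFn_mulFun f

theorem isShiftedInverse_boundedMul
    (hφ : Measurable fun k : EuclideanSpace ℝ (Fin n) => φ ‖k‖)
    (h0 : ∀ k : EuclideanSpace ℝ (Fin n), 0 ≤ φ ‖k‖) :
    IsShiftedInverse (mulOp n φ)
      (boundedMul (weight n φ) (measurable_weight hφ) 1 (abs_weight_le_one h0)) := by
  have hone : ∀ k, (φ ‖k‖ : ℂ) * (weight n φ k : ℂ) + (weight n φ k : ℂ) = 1 := fun k => by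
    exact_mod_cast one_add_mul_weight h0 k
  have hmem : ∀ g : L2 n, boundedMul (weight n φ) (measurable_weight hφ) 1
      (abs_weight_le_one h0) g ∈ (mulOp n φ).domain := by
    intro g
    refine (memLp_bounded_mul (m := fun k => φ ‖k‖ * weight n φ k) (C := 1)
      (hφ.mul (measurable_weight hφ)) (fun k => ?_) (Lp.memLp g)).ae_eq ?_
    · rw [eq_sub_of_add_eq (one_add_mul_weight h0 k)]
      exact abs_one_sub_weight_le_one h0 k
    · filter_upwards [coeFn_boundedMul (hm := measurable_weight hφ)
        (hC := abs_weight_le_one h0) g] with k hk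
      rw [hk]
      push_cast
      ring
  refine ⟨hmem, fun g => Lp.ext ?_, fun f => Lp.ext ?_⟩
  · filter_upwards [coeFn_boundedMul (hm := measurable_weight hφ) (hC := abs_weight_le_one h0) g,
      mulOp_apply_ae ⟨_, hmem g⟩, Lp.coeFn_add (mulOp n φ ⟨_, hmem g⟩)
        (boundedMul (weight n φ) (measurable_weight hφ) 1 (abs_weight_le_one h0) g)]
      with k h1 h2 h3
    rw [h3, Pi.add_apply, h2, h1]
    linear_combination g k * hone k
  · filter_upwards [coeFn_boundedMul (hm := measurable_weight hφ) (hC := abs_weight_le_one h0)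
      (mulOp n φ f + (f : L2 n)), mulOp_apply_ae f, Lp.coeFn_add (mulOp n φ f) (f : L2 n)] with k h1 h2 h3
    rw [h1, h3, Pi.add_apply, h2]
    linear_combination (f : L2 n) k * hone k

theorem mem_kerDeltaHat_iff {f : L2 n} :
    f ∈ kerDeltaHat n ↔ Integrable (fun k => f k) ∧ ∫ k, f k = 0 := by
  constructor
  · rintro ⟨g, hg, rfl⟩
    exact ⟨g.2, hg⟩
  · rintro ⟨h1, h2⟩
    exact ⟨⟨f, h1⟩, h2, rfl⟩

/-- Since `w (φ + 1) f = f`, the integral of `f` is `⟪w, (A + 1) f⟫`, and `f`, a product of two `L²`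
functions, is integrable. -/
theorem mem_mulOp₀_domain_iff
    (h0 : ∀ k : EuclideanSpace ℝ (Fin n), 0 ≤ φ ‖k‖)
    (hw : MemLp (fun k => (weight n φ k : ℂ)) 2 volume) (f : (mulOp n φ).domain) :
    (f : L2 n) ∈ (mulOp₀ n φ).domain ↔
      inner ℂ (hw.toLp _) (mulOp n φ f + f) = 0 := by
  have hone : ∀ k, (φ ‖k‖ : ℂ) * (weight n φ k : ℂ) + (weight n φ k : ℂ) = 1 := fun k => by
    exact_mod_cast one_add_mul_weight h0 k
  have hf : (fun k => (weight n φ k : ℂ) * (mulOp n φ f + f : L2 n) k) =ᵐ[volume]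
      fun k => (f : L2 n) k := by
    filter_upwards [mulOp_apply_ae f, Lp.coeFn_add (mulOp n φ f) (f : L2 n)] with k h1 h2
    rw [h2, Pi.add_apply, h1]
    linear_combination (f : L2 n) k * hone k
  have hi : Integrable (fun k => (f : L2 n) k) :=
    (hw.integrable_mul (Lp.memLp (mulOp n φ f + f : L2 n))).congr hf
  rw [inner_toLp_ofReal, integral_congr_ae hf]
  constructor
  · intro h
    exact (mem_kerDeltaHat_iff.1 h.1).2
  · intro h
    exact ⟨mem_kerDeltaHat_iff.2 ⟨hi, h⟩, f.2⟩

/-- Otherwise `(φ + 1) w = 1` would lie in `L²(ℝⁿ)`, which has infinite measure for `n ≥ 1`. -/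
theorem weight_notMem_domain (hn : 1 ≤ n) (h0 : ∀ k : EuclideanSpace ℝ (Fin n), 0 ≤ φ ‖k‖)
    (hw : MemLp (fun k => (weight n φ k : ℂ)) 2 volume) :
    hw.toLp _ ∉ (mulOp n φ).domain := by
  have : Nonempty (Fin n) := ⟨⟨0, hn⟩⟩
  intro h
  have h1 : MemLp (fun _ : EuclideanSpace ℝ (Fin n) => (1 : ℂ)) 2 volume := by
    have h2 : MemLp (fun k => (φ ‖k‖ : ℂ) * hw.toLp _ k) 2 volume := h
    refine (h2.add hw).ae_eq ?_
    filter_upwards [hw.coeFn_toLp] with k hk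
    rw [Pi.add_apply, hk]
    exact_mod_cast one_add_mul_weight h0 k
  rw [memLp_const_iff (by simp) (by simp)] at h1
  rcases h1 with h1 | h1
  · exact one_ne_zero h1
  · exact h1.ne (measure_univ_of_isAddLeftInvariant _)

/-- The multiplication operator has a non-negative singular perturbation if and only if
`1 / (φ (1 + φ))` or `1 / (1 + φ)` is integrable over `ℝⁿ`. -/
theorem exists_nonneg_extension_mulOp_iff (hn : 1 ≤ n)
    (hφ : Measurable fun k : EuclideanSpace ℝ (Fin n) => φ ‖k‖)
    (h0 : ∀ k : EuclideanSpace ℝ (Fin n), 0 ≤ φ ‖k‖)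
    (hpos : ∀ᵐ k : EuclideanSpace ℝ (Fin n), 0 < φ ‖k‖)
    (hw : Integrable fun k : EuclideanSpace ℝ (Fin n) => 1 / (1 + φ ‖k‖) ^ 2) :
    IsNonnegSelfAdjoint (mulOp n φ) ∧
    ((∃ B : L2 n →ₗ.[ℂ] L2 n, IsNonnegSelfAdjoint B ∧ mulOp₀ n φ ≤ B ∧ B ≠ mulOp n φ) ↔
      (Integrable fun k : EuclideanSpace ℝ (Fin n) => 1 / (φ ‖k‖ * (1 + φ ‖k‖))) ∨
      (Integrable fun k : EuclideanSpace ℝ (Fin n) => 1 / (1 + φ ‖k‖))) := by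
  have hwm := measurable_weight hφ
  have hw2 : MemLp (fun k => (weight n φ k : ℂ)) 2 volume := by
    refine (memLp_two_iff_integrable_sq_norm
      (Complex.measurable_ofReal.comp hwm).aestronglyMeasurable).2 (hw.congr ?_)
    refine ae_of_all _ fun k => ?_
    change _ = ‖(weight n φ k : ℂ)‖ ^ 2
    rw [Complex.norm_real, Real.norm_eq_abs, sq_abs, weight, inv_pow, ← one_div]
  have hR := isShiftedInverse_boundedMul hφ h0
  have hsym := boundedMul_isSymmetric (μ := (volume : Measure (EuclideanSpace ℝ (Fin n))))
    (hm := hwm) (hC := abs_weight_le_one h0)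
  have hsub : ∀ g : L2 n, ‖g‖ ^ 2 - (inner ℂ (boundedMul (weight n φ) hwm 1
      (abs_weight_le_one h0) g) g).re = ∫ k, (1 - weight n φ k) * ‖g k‖ ^ 2 := by
    intro g
    have h1 := integrable_mul_norm_sq hwm (abs_weight_le_one h0) g
    have h2 := (memLp_two_iff_integrable_sq_norm (Lp.memLp g).1).1 (Lp.memLp g)
    rw [re_inner_boundedMul, norm_sq_eq_integral, ← integral_sub h2 h1]
    simp only [sub_mul, one_mul]
  have hr0 : ∀ g : L2 n, 0 ≤ (inner ℂ (boundedMul (weight n φ) hwm 1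
      (abs_weight_le_one h0) g) g).re := by
    intro g
    rw [re_inner_boundedMul]
    exact integral_nonneg fun k => mul_nonneg (weight_pos h0 k).le (sq_nonneg _)
  have hr1 : ∀ g : L2 n, (inner ℂ (boundedMul (weight n φ) hwm 1
      (abs_weight_le_one h0) g) g).re ≤ ‖g‖ ^ 2 := by
    intro g
    rw [← sub_nonneg, hsub]
    exact integral_nonneg fun k =>
      mul_nonneg (sub_nonneg.2 (weight_le_one h0 k)) (sq_nonneg _)
  refine ⟨hR.isNonnegSelfAdjoint hsym (norm_sq_map_le_re_inner hsym hr0 hr1), ?_⟩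
  rw [exists_nonneg_extension_ne_iff hR hsym hr0 hr1 (A₀ := mulOp₀ n φ) LinearPMap.domRestrict_le
    (mem_mulOp₀_domain_iff h0 hw2) (weight_notMem_domain hn h0 hw2), or_comm]
  simp only [hsub]
  simp only [re_inner_boundedMul]
  have hone_sub : ∀ k, 1 - weight n φ k = φ ‖k‖ * weight n φ k := fun k =>
    (eq_sub_of_add_eq (one_add_mul_weight h0 k)).symm
  rw [exists_rankOne_le_iff_integrable hwm (abs_weight_le_one h0) (ae_of_all _ (weight_pos h0))
    hwm hw2, exists_rankOne_le_iff_integrable (m := fun k => 1 - weight n φ k)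
    (measurable_const.sub hwm) (abs_one_sub_weight_le_one h0) (by
      filter_upwards [hpos] with k hk
      rw [hone_sub]
      exact mul_pos hk (weight_pos h0 k)) hwm hw2]
  -- Here `w² / (1 - w) = 1 / (φ (1 + φ))` where `φ > 0`, and `w² / w = 1 / (1 + φ)`.
  refine or_congr (integrable_congr ?_) (integrable_congr (ae_of_all _ fun k => ?_))
  · filter_upwards [hpos] with k hk
    have h1 : 1 + φ ‖k‖ ≠ 0 := by linarith
    rw [hone_sub, weight]
    field_simp
  · have h1 : 1 + φ ‖k‖ ≠ 0 := by linarith [h0 k]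
    change weight n φ k ^ 2 / weight n φ k = _
    rw [weight]
    field_simp

end Multiplication

/-! ### Passage to half-line integrals and conclusion -/

theorem lintegral_ofReal_eq_top_iff {f : ℝ → ℝ}
    (hm : AEStronglyMeasurable f (volume.restrict (Ioi (0 : ℝ))))
    (h0 : 0 ≤ᵐ[volume.restrict (Ioi (0 : ℝ))] f) :
    (∫⁻ k in Ioi (0 : ℝ), ENNReal.ofReal (f k)) = ∞ ↔ ¬ IntegrableOn f (Ioi 0) := by
  rw [IntegrableOn, ← lintegral_ofReal_ne_top_iff_integrable hm h0, not_not]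

end SingularPerturbation

theorem mainTheorem4 (n : ℕ) (hn : 1 ≤ n) (φ : ℝ → ℝ)
    (hφ : ContinuousOn φ (Set.Ici 0))
    (hpos : ∀ᵐ k ∂(MeasureTheory.volume.restrict (Set.Ioi (0 : ℝ))), 0 < φ k)
    (hint : (∫⁻ k in Set.Ioi (0 : ℝ), ENNReal.ofReal (k ^ (n - 1) / (1 + φ k) ^ 2)) < ∞) :
    (SingularPerturbation.IsUniqueNonnegExtension
        (SingularPerturbation.mulOp₀ n φ) (SingularPerturbation.mulOp n φ) ↔
      (∫⁻ k in Set.Ioi (0 : ℝ), ENNReal.ofReal (k ^ (n - 1) / (φ k * (1 + φ k)))) = ∞ ∧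
      (∫⁻ k in Set.Ioi (0 : ℝ), ENNReal.ofReal (k ^ (n - 1) / (1 + φ k))) = ∞) ∧
    ((¬ ∃ B : SingularPerturbation.L2 n →ₗ.[ℂ] SingularPerturbation.L2 n,
        SingularPerturbation.IsSingularPerturbation
          (SingularPerturbation.mulOp₀ n φ) (SingularPerturbation.mulOp n φ) B ∧
        SingularPerturbation.IsNonnegSelfAdjoint B) ↔
      (∫⁻ k in Set.Ioi (0 : ℝ), ENNReal.ofReal (k ^ (n - 1) / (φ k * (1 + φ k)))) = ∞ ∧
      (∫⁻ k in Set.Ioi (0 : ℝ), ENNReal.ofReal (k ^ (n - 1) / (1 + φ k))) = ∞) := by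
  have hcont : Continuous fun k : EuclideanSpace ℝ (Fin n) => φ ‖k‖ :=
    hφ.comp_continuous continuous_norm fun k => norm_nonneg k
  have hposE : ∀ᵐ k : EuclideanSpace ℝ (Fin n), 0 < φ ‖k‖ :=
    SingularPerturbation.ae_comp_norm_of_ae hn hpos
  -- By continuity the set where `φ(|k|) < 0` is open; it is null, hence empty.
  have h0 : ∀ k : EuclideanSpace ℝ (Fin n), 0 ≤ φ ‖k‖ := by
    have hopen : IsOpen {k : EuclideanSpace ℝ (Fin n) | φ ‖k‖ < 0} :=
      isOpen_lt hcont continuous_const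
    have hnull : volume {k : EuclideanSpace ℝ (Fin n) | φ ‖k‖ < 0} = 0 :=
      measure_mono_null (fun k (hk : φ ‖k‖ < 0) => not_lt.2 hk.le) (ae_iff.1 hposE)
    intro k
    by_contra! hk
    have := hopen.measure_eq_zero_iff volume |>.1 hnull
    exact (this ▸ hk : k ∈ (∅ : Set (EuclideanSpace ℝ (Fin n))))
  have hφm : AEMeasurable φ (volume.restrict (Set.Ioi (0 : ℝ))) :=
    (hφ.mono Set.Ioi_subset_Ici_self).aemeasurable measurableSet_Ioi
  have hpow : AEMeasurable (fun k : ℝ => k ^ (n - 1)) (volume.restrict (Set.Ioi (0 : ℝ))) :=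
    (measurable_id.pow_const _).aemeasurable
  have hk : ∀ᵐ k ∂(volume.restrict (Set.Ioi (0 : ℝ))), 0 < k := ae_restrict_mem measurableSet_Ioi
  have hL2 : Integrable fun k : EuclideanSpace ℝ (Fin n) => 1 / (1 + φ ‖k‖) ^ 2 := by
    rw [SingularPerturbation.integrable_comp_norm_iff (f := fun k => 1 / (1 + φ k) ^ 2) hn]
    simp only [mul_one_div]
    by_contra h
    refine hint.ne ((SingularPerturbation.lintegral_ofReal_eq_top_iff
      (hpow.div ((hφm.const_add 1).pow_const 2)).aestronglyMeasurable ?_).2 h)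
    filter_upwards [hk] with k hk
    exact div_nonneg (pow_nonneg hk.le _) (sq_nonneg _)
  have e1 : (∫⁻ k in Set.Ioi (0 : ℝ), ENNReal.ofReal (k ^ (n - 1) / (φ k * (1 + φ k)))) = ∞ ↔
      ¬ Integrable fun k : EuclideanSpace ℝ (Fin n) => 1 / (φ ‖k‖ * (1 + φ ‖k‖)) := by
    rw [SingularPerturbation.integrable_comp_norm_iff (f := fun k => 1 / (φ k * (1 + φ k))) hn]
    simp only [mul_one_div]
    refine SingularPerturbation.lintegral_ofReal_eq_top_iff
      (hpow.div (hφm.mul (hφm.const_add 1))).aestronglyMeasurable ?_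
    filter_upwards [hpos, hk] with k h1 h2
    positivity
  have e2 : (∫⁻ k in Set.Ioi (0 : ℝ), ENNReal.ofReal (k ^ (n - 1) / (1 + φ k))) = ∞ ↔
      ¬ Integrable fun k : EuclideanSpace ℝ (Fin n) => 1 / (1 + φ ‖k‖) := by
    rw [SingularPerturbation.integrable_comp_norm_iff (f := fun k => 1 / (1 + φ k)) hn]
    simp only [mul_one_div]
    refine SingularPerturbation.lintegral_ofReal_eq_top_iff
      (hpow.div (hφm.const_add 1)).aestronglyMeasurable ?_
    filter_upwards [hpos, hk] with k h1 h2
    positivity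
  obtain ⟨hA, hiff⟩ := SingularPerturbation.exists_nonneg_extension_mulOp_iff hn
    hcont.measurable h0 hposE hL2
  have hle : SingularPerturbation.mulOp₀ n φ ≤ SingularPerturbation.mulOp n φ :=
    LinearPMap.domRestrict_le
  rw [e1, e2, ← not_or, ← hiff]
  constructor
  · constructor
    · rintro ⟨-, h⟩ ⟨B, hB, hleB, hne⟩
      exact hne (h B hB hleB)
    · intro h
      refine ⟨⟨hA, hle⟩, fun B hB hleB => ?_⟩
      by_contra hne
      exact h ⟨B, hB, hleB, hne⟩
  · refine not_congr (exists_congr fun B => ?_)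
    constructor
    · rintro ⟨⟨-, hleB, hne⟩, hB⟩
      exact ⟨hB, hleB, hne⟩
    · rintro ⟨hB, hleB, hne⟩
      exact ⟨⟨hB.1, hleB, hne⟩, hB⟩
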